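/- **Truth values.** Let $\mathbf 4=\{1,\mathbf b,\mathbf n,0\}$, ordered as a lattice with least element $0$, greatest element $1$ and $\mathbf b,\mathbf n$ incomparable; let $\wedge,\vee$ be its meet and join. Let $\neg 1=0$, $\neg\mathbf b=\mathbf b$, $\neg\mathbf n=\mathbf n$, $\neg 0=1$, and $\copyright 1=1$, $\copyright\mathbf b=0$, $\copyright\mathbf n=\mathbf b$, $\copyright 0=1$. Let $1\to y=\mathbf b\to y=y$ and $0\to y=1$ for all $y$, and $\mathbf n\to 1=1$, $\mathbf n\to\mathbf b=\mathbf b$, $\mathbf n\to\mathbf n=1$, $\mathbf n\to 0=\mathbf b$. The designated values are $1$ and $\mathbf b$. **Language and semantics.** Let $\mathcal S$ be a first-order signature (predicate, function and constant symbols, of any cardinality), with a denumerable set of variables. Formulas are built from atomic formulas $P(t_1,\dots,t_n)$ by $\wedge,\vee,\to,\neg,\copyright,\forall,\exists$. A $\mathbf 4$-structure $\mathfrak A$ consists of a non-empty set $A$, a function $A^n\to\mathbf 4$ for each $n$-ary predicate symbol, a function $A^n\to A$ for each $n$-ary function symbol, and an element of $A$ for each constant symbol. For an assignment $s$ of elements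 of $A$ to the variables, the value $\|\varphi\|(s)\in\mathbf 4$ is defined recursively: an atomic formula takes the value of its predicate at the values of its terms, connectives are interpreted by the operations of $\mathbf 4$, and $\|\forall x\varphi\|(s)=\inf_{a\in A}\|\varphi\|(s_x^a)$, $\|\exists x\varphi\|(s)=\sup_{a\in A}\|\varphi\|(s_x^a)$, where $s_x^a$ is $s$ with the value at $x$ changed to $a$. $\mathfrak A$ is a model of $\varphi$ if $\|\varphi\|(s)\in\{1,\mathbf b\}$ for every assignment $s$. Write $\Delta\models_{\sf QBD2}\varphi$ if every $\mathbf 4$-structure that is a model of all formulas of $\Delta$ is a model of $\varphi$. **Calculus.** ${\sf HQBD2}$ is the Hilbert calculus over the formulas without $\exists$ with the following axiom schemata, where $\alpha\leftrightarrow\beta$ abbreviates $(\alpha\to\beta)\wedge(\beta\to\alpha)$: * $\alpha\to(\beta\to\alpha)$; $\ (\alpha\to(\beta\to\gamma))\to((\alpha\to\beta)\to(\alpha\to\gamma))$; $\ \alpha\wedge\beta\to\alpha$; $\ \alpha\wedge\beta\to\beta$; $\ \alpha\to(\beta\to(\alpha\wedge\beta))$; $\ \alpha\to(\alpha\vee\beta)$;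 $\ \alpha\to(\beta\vee\alpha)$; $\ (\alpha\to\gamma)\to((\beta\to\gamma)\to(\alpha\vee\beta\to\gamma))$; $\ \alpha\vee(\alpha\to\beta)$; * $\neg\neg\alpha\leftrightarrow\alpha$; $\ \neg(\alpha\vee\beta)\leftrightarrow(\neg\alpha\wedge\neg\beta)$; $\ \neg(\alpha\wedge\beta)\leftrightarrow(\neg\alpha\vee\neg\beta)$; $\ \neg(\alpha\to\beta)\leftrightarrow((\neg\alpha\to\alpha)\wedge\neg\beta)$; * $(\copyright\alpha\wedge(\alpha\wedge\neg\alpha))\to\beta$; $\ \copyright\alpha\vee(\alpha\wedge\neg\alpha)$; $\ \neg\copyright\alpha\leftrightarrow(\alpha\leftrightarrow\neg\alpha)$; * $\forall x\varphi\to\varphi[x/t]$ and $\neg\varphi[x/t]\to\neg\forall x\varphi$, where $t$ is a term free for $x$ in $\varphi$ and $\varphi[x/t]$ is the result of replacing the free occurrences of $x$ by $t$; $\ \neg\forall x\varphi\to\neg\forall x\neg\neg\varphi$; and the rules: modus ponens; from $\alpha\to\beta$ infer $\alpha\to\forall x\beta$, and from $\beta\to\alpha$ infer $\neg\forall x\neg\beta\to\alpha$,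 both provided that $x$ is not free in $\alpha$. Write $\Delta\vdash_{\sf HQBD2}\varphi$ if there is a derivation of $\varphi$ in which formulas of $\Delta$ may be used as premises. **Theorem (Adequacy).** For every signature $\mathcal S$, every set $\Delta$ of formulas without $\exists$ and every formula $\varphi$ without $\exists$, possibly with free variables (so in particular for sentences), $$\Delta\models_{\sf QBD2}\varphi\quad\Longleftrightarrow\quad\Delta\vdash_{\sf HQBD2}\varphi .$$ For arbitrary $\Delta$ and $\varphi$, possibly containing $\exists$, the same equivalence holds when in the right-hand side each $\exists x\psi$ is read as the abbreviation of $\neg\forall x\neg\psi$. -/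

import Mathlib

universe u v w

namespace QBD2

/-! ### The four truth values and the matrix of BD2 -/

/-- The set of truth values `{1, b, n, 0}`. -/
inductive Four : Type
  | one
  | b
  | n
  | zero
  deriving DecidableEq

namespace Four

instance : Fintype Four := ⟨{one, b, n, zero}, fun x => by cases x <;> decide⟩

/-- The truth table of conjunction. -/
def and : Four → Four → Four
  | one, y => y
  | b, one => b
  | b, b => b
  | b, n => zero
  | b, zero => zero
  | n, one => n
  | n, b => zero
  | n, n => n
  | n, zero => zero
  | zero, _ => zero

/-- The truth table of disjunction. -/
def or : Four → Four → Four
  | one, _ => one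
  | b, one => one
  | b, b => b
  | b, n => one
  | b, zero => b
  | n, one => one
  | n, b => one
  | n, n => n
  | n, zero => n
  | zero, y => y

/-- The truth table of the negation `¬`. -/
def neg : Four → Four
  | one => zero
  | b => b
  | n => n
  | zero => one

/-- The truth table of the implication `→`. -/
def imp : Four → Four → Four
  | one, y => y
  | b, y => y
  | n, one => one
  | n, b => b
  | n, n => one
  | n, zero => b
  | zero, _ => one

/-- The truth table of the weak consistency operator `©`. -/
def cons : Four → Four
  | one => one
  | b => zero
  | n => b
  | zero => one

/-- The designated values are `1` and `b`. -/
def designated : Set Four := {one, b}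

/-- The lattice order of `4`: `0` is the least element, `1` the greatest, and `b`, `n` are
incomparable. It is the order determined by the table of conjunction. -/
instance : LE Four := ⟨fun x y => and x y = x⟩

instance : DecidableRel (α := Four) (· ≤ ·) :=
  fun x y => inferInstanceAs (Decidable (and x y = x))

instance : Lattice Four where
  le_refl := by decide
  le_trans := by decide
  le_antisymm := by decide
  sup := or
  inf := and
  le_sup_left := by decide
  le_sup_right := by decide
  sup_le := by decide
  inf_le_left := by decide
  inf_le_right := by decide
  le_inf := by decide

instance : BoundedOrder Four where
  top := one
  bot := zero
  le_top := by decide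
  bot_le := by decide

/-- The finite lattice `4` is complete; this provides `⨅` and `⨆`. -/
noncomputable instance : CompleteLattice Four := Fintype.toCompleteLattice Four

end Four

/-! ### Syntax

A first-order signature is a `FirstOrder.Language`; its constant symbols are the function symbols
of arity `0`. The individual variables are the natural numbers, and terms are `L.Term ℕ`. -/

/-- Formulas of the language `L(∀, ∃, {∧, ∨, →, ¬, ©}, S)`. -/
inductive Formula (L : FirstOrder.Language.{u, v}) : Type (max u v)
  | rel {k : ℕ} (P : L.Relations k) (ts : Fin k → L.Term ℕ) : Formula L
  | and (φ ψ : Formula L) : Formula L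
  | or (φ ψ : Formula L) : Formula L
  | imp (φ ψ : Formula L) : Formula L
  | neg (φ : Formula L) : Formula L
  | cons (φ : Formula L) : Formula L
  | all (x : ℕ) (φ : Formula L) : Formula L
  | ex (x : ℕ) (φ : Formula L) : Formula L

/-- Formulas of the language `L(∀, {∧, ∨, →, ¬, ©}, S)`, over which the calculus is defined. -/
inductive UFormula (L : FirstOrder.Language.{u, v}) : Type (max u v)
  | rel {k : ℕ} (P : L.Relations k) (ts : Fin k → L.Term ℕ) : UFormula L
  | and (φ ψ : UFormula L) : UFormula L
  | or (φ ψ : UFormula L) : UFormula L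
  | imp (φ ψ : UFormula L) : UFormula L
  | neg (φ : UFormula L) : UFormula L
  | cons (φ : UFormula L) : UFormula L
  | all (x : ℕ) (φ : UFormula L) : UFormula L

namespace UFormula

variable {L : FirstOrder.Language.{u, v}}

/-- The inclusion of the language with `∀` only into the language with both quantifiers. -/
def toFormula : UFormula L → Formula L
  | rel P ts => .rel P ts
  | and φ ψ => .and φ.toFormula ψ.toFormula
  | or φ ψ => .or φ.toFormula ψ.toFormula
  | imp φ ψ => .imp φ.toFormula ψ.toFormula
  | neg φ => .neg φ.toFormula
  | cons φ => .cons φ.toFormula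
  | all x φ => .all x φ.toFormula

/-- `α ↔ β` abbreviates `(α → β) ∧ (β → α)`. -/
def iff (α β : UFormula L) : UFormula L := (α.imp β).and (β.imp α)

/-- The variables that occur free in a formula. -/
def freeVars : UFormula L → Finset ℕ
  | rel _ ts => Finset.univ.biUnion fun i => (ts i).varFinset
  | and φ ψ => φ.freeVars ∪ ψ.freeVars
  | or φ ψ => φ.freeVars ∪ ψ.freeVars
  | imp φ ψ => φ.freeVars ∪ ψ.freeVars
  | neg φ => φ.freeVars
  | cons φ => φ.freeVars
  | all x φ => φ.freeVars.erase x

/-- `φ.subst x t` replaces every free occurrence of the variable `x` in `φ` by the term `t`. -/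
def subst (x : ℕ) (t : L.Term ℕ) : UFormula L → UFormula L
  | rel P ts => rel P fun i => (ts i).subst (Function.update FirstOrder.Language.Term.var x t)
  | and φ ψ => and (φ.subst x t) (ψ.subst x t)
  | or φ ψ => or (φ.subst x t) (ψ.subst x t)
  | imp φ ψ => imp (φ.subst x t) (ψ.subst x t)
  | neg φ => neg (φ.subst x t)
  | cons φ => cons (φ.subst x t)
  | all y φ => if y = x then all y φ else all y (φ.subst x t)

/-- The term `t` is free for `x` in a formula: no free occurrence of `x` lies in the scope of a
quantifier that binds a variable of `t`. -/
def FreeFor (x : ℕ) (t : L.Term ℕ) : UFormula L → Prop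
  | rel _ _ => True
  | and φ ψ => φ.FreeFor x t ∧ ψ.FreeFor x t
  | or φ ψ => φ.FreeFor x t ∧ ψ.FreeFor x t
  | imp φ ψ => φ.FreeFor x t ∧ ψ.FreeFor x t
  | neg φ => φ.FreeFor x t
  | cons φ => φ.FreeFor x t
  | all y φ => x ∉ (all y φ).freeVars ∨ (y ∉ t.varFinset ∧ φ.FreeFor x t)

end UFormula

/-- Reading `∃x φ` as the abbreviation of `¬∀x¬φ`. -/
def Formula.unfoldEx {L : FirstOrder.Language.{u, v}} : Formula L → UFormula L
  | .rel P ts => .rel P ts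
  | .and φ ψ => .and φ.unfoldEx ψ.unfoldEx
  | .or φ ψ => .or φ.unfoldEx ψ.unfoldEx
  | .imp φ ψ => .imp φ.unfoldEx ψ.unfoldEx
  | .neg φ => .neg φ.unfoldEx
  | .cons φ => .cons φ.unfoldEx
  | .all x φ => .all x φ.unfoldEx
  | .ex x φ => .neg (.all x (.neg φ.unfoldEx))

/-! ### Semantics -/

/-- A `4`-structure (partial structure) over the signature `L`. -/
structure FourStructure (L : FirstOrder.Language.{u, v}) : Type (max u v (w + 1)) where
  Carrier : Type w
  nonempty : Nonempty Carrier
  relMap : ∀ {k : ℕ}, L.Relations k → (Fin k → Carrier) → Four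
  funMap : ∀ {k : ℕ}, L.Functions k → (Fin k → Carrier) → Carrier

namespace FourStructure

variable {L : FirstOrder.Language.{u, v}} (A : FourStructure.{u, v, w} L)

/-- The value of a term under the assignment `s`. -/
def termVal (s : ℕ → A.Carrier) : L.Term ℕ → A.Carrier
  | .var x => s x
  | .func f ts => A.funMap f fun i => termVal s (ts i)

/-- The value of a formula under the assignment `s`. -/
noncomputable def val : Formula L → (ℕ → A.Carrier) → Four
  | .rel P ts, s => A.relMap P fun i => A.termVal s (ts i)
  | .and φ ψ, s => (val φ s).and (val ψ s)
  | .or φ ψ, s => (val φ s).or (val ψ s)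
  | .imp φ ψ, s => (val φ s).imp (val ψ s)
  | .neg φ, s => (val φ s).neg
  | .cons φ, s => (val φ s).cons
  | .all x φ, s => ⨅ a : A.Carrier, val φ (Function.update s x a)
  | .ex x φ, s => ⨆ a : A.Carrier, val φ (Function.update s x a)

/-- `A` is a model of `φ` if every assignment gives `φ` a designated value. -/
def IsModel (φ : Formula L) : Prop :=
  ∀ s : ℕ → A.Carrier, A.val φ s ∈ Four.designated

end FourStructure

/-- Semantic consequence of QBD2: every model of `Δ` is a model of `φ`. -/
def Consequence {L : FirstOrder.Language.{u, v}} (Δ : Set (Formula L)) (φ : Formula L) : Prop :=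
  ∀ A : FourStructure.{u, v, w} L, (∀ δ ∈ Δ, A.IsModel δ) → A.IsModel φ

/-! ### The Hilbert calculus HQBD2 -/

/-- The axioms of HQBD2. -/
inductive HilbertAx {L : FirstOrder.Language.{u, v}} : UFormula L → Prop
  | pos1 (α β : UFormula L) : HilbertAx (α.imp (β.imp α))
  | pos2 (α β γ : UFormula L) :
      HilbertAx ((α.imp (β.imp γ)).imp ((α.imp β).imp (α.imp γ)))
  | pos3 (α β : UFormula L) : HilbertAx ((α.and β).imp α)
  | pos4 (α β : UFormula L) : HilbertAx ((α.and β).imp β)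
  | pos5 (α β : UFormula L) : HilbertAx (α.imp (β.imp (α.and β)))
  | pos6 (α β : UFormula L) : HilbertAx (α.imp (α.or β))
  | pos7 (α β : UFormula L) : HilbertAx (α.imp (β.or α))
  | pos8 (α β γ : UFormula L) :
      HilbertAx ((α.imp γ).imp ((β.imp γ).imp ((α.or β).imp γ)))
  | pos9 (α β : UFormula L) : HilbertAx (α.or (α.imp β))
  | dneg (α : UFormula L) : HilbertAx (α.neg.neg.iff α)
  | dm1 (α β : UFormula L) : HilbertAx ((α.or β).neg.iff (α.neg.and β.neg))
  | dm2 (α β : UFormula L) : HilbertAx ((α.and β).neg.iff (α.neg.or β.neg))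
  | dm3 (α β : UFormula L) : HilbertAx ((α.imp β).neg.iff ((α.neg.imp α).and β.neg))
  | cons1 (α β : UFormula L) : HilbertAx ((α.cons.and (α.and α.neg)).imp β)
  | cons2 (α : UFormula L) : HilbertAx (α.cons.or (α.and α.neg))
  | cons3 (α : UFormula L) : HilbertAx (α.cons.neg.iff (α.iff α.neg))
  | allA (x : ℕ) (t : L.Term ℕ) (φ : UFormula L) (h : φ.FreeFor x t) :
      HilbertAx ((φ.all x).imp (φ.subst x t))
  | allB (x : ℕ) (φ : UFormula L) : HilbertAx ((φ.all x).neg.imp (φ.neg.neg.all x).neg)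
  | allC (x : ℕ) (t : L.Term ℕ) (φ : UFormula L) (h : φ.FreeFor x t) :
      HilbertAx ((φ.subst x t).neg.imp (φ.all x).neg)

/-- Derivability in HQBD2 from a set of formulas. -/
inductive Derivable {L : FirstOrder.Language.{u, v}} (Γ : Set (UFormula L)) : UFormula L → Prop
  | hyp {φ : UFormula L} (h : φ ∈ Γ) : Derivable Γ φ
  | ax {φ : UFormula L} (h : HilbertAx φ) : Derivable Γ φ
  | mp {φ ψ : UFormula L} (h₁ : Derivable Γ (φ.imp ψ)) (h₂ : Derivable Γ φ) : Derivable Γ ψ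
  | allIn1 {α β : UFormula L} (x : ℕ) (hx : x ∉ α.freeVars) (h : Derivable Γ (α.imp β)) :
      Derivable Γ (α.imp (β.all x))
  | allIn2 {α β : UFormula L} (x : ℕ) (hx : x ∉ α.freeVars) (h : Derivable Γ (β.imp α)) :
      Derivable Γ ((β.neg.all x).neg.imp α)

end QBD2

/-!
An element of `4` is determined by two bits: whether it is designated and whether its negation is.
Hence a set `T` of formulas that behaves classically towards the definable classical negation
`α.strongNeg` yields a valuation, which reads the two bits of `α` off from `α ∈ T` and `¬α ∈ T`.
One bit of an infimum asks whether all values are designated, the other whether some negation is, so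
`T` respects quantifiers if instances witness both the failure of `∀x ψ` and the truth of `¬∀x ψ`.

Ultraproducts of `4`-structures satisfy Łoś's theorem, because `4` is finite. So it suffices to
refute `φ` in a model of finitely many premises, which may be replaced by their universal closures.
Then only countably many formulas matter, although the signature is arbitrary, and Rasiowa–Sikorski
produces a suitable `T`. Free variables are not subject to generalization inside `T` and thus play
the part of the Henkin constants.
-/

universe w'

namespace QBD2

/-! ### The matrix of BD2 -/

namespace Four

instance : DecidablePred (· ∈ designated) :=
  fun x => decidable_of_iff (x = one ∨ x = b) Iff.rfl

theorem and_mem_designated {x y : Four} :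
    x.and y ∈ designated ↔ x ∈ designated ∧ y ∈ designated := by
  revert x y; decide

theorem or_mem_designated {x y : Four} :
    x.or y ∈ designated ↔ x ∈ designated ∨ y ∈ designated := by
  revert x y; decide

theorem imp_mem_designated {x y : Four} :
    x.imp y ∈ designated ↔ (x ∈ designated → y ∈ designated) := by
  revert x y; decide

theorem cons_mem_designated {x : Four} :
    x.cons ∈ designated ↔ ¬(x ∈ designated ∧ x.neg ∈ designated) := by
  revert x; decide

theorem neg_imp_mem_designated {x y : Four} :
    (x.imp y).neg ∈ designated ↔ (x.neg ∈ designated → x ∈ designated) ∧ y.neg ∈ designated := by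
  revert x y; decide

theorem neg_cons_mem_designated {x : Four} :
    x.cons.neg ∈ designated ↔ (x ∈ designated ↔ x.neg ∈ designated) := by
  revert x; decide

theorem neg_neg (x : Four) : x.neg.neg = x := by
  revert x; decide

theorem neg_and (x y : Four) : (x.and y).neg = x.neg.or y.neg := by
  revert x y; decide

theorem neg_or (x y : Four) : (x.or y).neg = x.neg.and y.neg := by
  revert x y; decide

theorem ext_designated {x y : Four} (h : x ∈ designated ↔ y ∈ designated)
    (hn : x.neg ∈ designated ↔ y.neg ∈ designated) : x = y := by
  revert x y; decide

theorem mem_designated_iff_b_le {x : Four} : x ∈ designated ↔ b ≤ x := by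
  revert x; decide

theorem mem_designated_iff_not_le_n {x : Four} : x ∈ designated ↔ ¬x ≤ n := by
  revert x; decide

theorem neg_le_neg_iff {x y : Four} : x.neg ≤ y.neg ↔ y ≤ x := by
  revert x y; decide

/-- The negation as an order isomorphism from `4` to its dual, through which `¬` exchanges infima
and suprema. -/
def negOrderIso : Four ≃o Fourᵒᵈ where
  toFun x := OrderDual.toDual x.neg
  invFun x := (OrderDual.ofDual x).neg
  left_inv := neg_neg
  right_inv := neg_neg
  map_rel_iff' := neg_le_neg_iff

section Quantifiers

variable {ι : Sort*} {f : ι → Four}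

theorem iInf_mem_designated : ⨅ i, f i ∈ designated ↔ ∀ i, f i ∈ designated := by
  simp only [mem_designated_iff_b_le, le_iInf_iff]

theorem iSup_mem_designated : ⨆ i, f i ∈ designated ↔ ∃ i, f i ∈ designated := by
  simp only [mem_designated_iff_not_le_n, iSup_le_iff, not_forall]

theorem neg_iInf (f : ι → Four) : (⨅ i, f i).neg = ⨆ i, (f i).neg :=
  map_iInf negOrderIso f

end Quantifiers

/-- The truth value that is designated if and only if `p` holds and whose negation is designated if
and only if `q` holds: BD2 values are pairs of independent classical ones. -/
noncomputable def ofDesignated (p q : Prop) : Four :=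
  open Classical in if p then (if q then b else one) else (if q then zero else n)

theorem ofDesignated_mem_designated {p q : Prop} : ofDesignated p q ∈ designated ↔ p := by
  by_cases p <;> by_cases q <;> simp_all [ofDesignated, designated]

theorem neg_ofDesignated_mem_designated {p q : Prop} :
    (ofDesignated p q).neg ∈ designated ↔ q := by
  by_cases p <;> by_cases q <;> simp_all [ofDesignated, designated, neg]

end Four

/-! ### Simultaneous substitution -/

section Terms

open FirstOrder.Language (Term)

variable {L : FirstOrder.Language.{u, v}}

theorem term_subst_congr {σ τ : ℕ → L.Term ℕ} (t : L.Term ℕ)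
    (h : ∀ x ∈ t.varFinset, σ x = τ x) : t.subst σ = t.subst τ := by
  induction t with
  | var x => exact h x (by simp)
  | func f ts ih =>
    simp only [Term.subst]
    congr 1
    funext i
    exact ih i fun x hx => h x (by simpa using ⟨i, hx⟩)

theorem term_subst_var (t : L.Term ℕ) : t.subst Term.var = t := by
  induction t with
  | var x => rfl
  | func f ts ih => simp only [Term.subst, ih]

theorem term_subst_subst (σ τ : ℕ → L.Term ℕ) (t : L.Term ℕ) :
    (t.subst σ).subst τ = t.subst fun x => (σ x).subst τ := by
  induction t with
  | var x => rfl
  | func f ts ih => simp only [Term.subst, ih]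

theorem term_subst_update_of_notMem {x : ℕ} {t s : L.Term ℕ} (h : x ∉ t.varFinset) :
    t.subst (Function.update Term.var x s) = t :=
  (term_subst_congr t fun _ hy =>
    Function.update_of_ne (ne_of_mem_of_not_mem hy h) _ _).trans (term_subst_var t)

theorem notMem_varFinset_subst {x : ℕ} {σ : ℕ → L.Term ℕ} (h : ∀ y, x ∉ (σ y).varFinset)
    (t : L.Term ℕ) : x ∉ (t.subst σ).varFinset := by
  induction t with
  | var y => exact h y
  | func f ts ih => simpa using ih

end Terms

namespace UFormula

open FirstOrder.Language (Term)

variable {L : FirstOrder.Language.{u, v}}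

/-- The variables that are bound by some quantifier of a formula; a term without these variables
can be substituted without capture. -/
def boundVars : UFormula L → Finset ℕ
  | rel _ _ => ∅
  | and φ ψ => φ.boundVars ∪ ψ.boundVars
  | or φ ψ => φ.boundVars ∪ ψ.boundVars
  | imp φ ψ => φ.boundVars ∪ ψ.boundVars
  | neg φ => φ.boundVars
  | cons φ => φ.boundVars
  | all x φ => insert x φ.boundVars

/-- Simultaneous substitution for the free variables. Bound variables are not renamed, so variables
of the substituted terms may get captured. -/
def msubst : UFormula L → (ℕ → L.Term ℕ) → UFormula L
  | rel P ts, σ => rel P fun i => (ts i).subst σ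
  | and φ ψ, σ => and (φ.msubst σ) (ψ.msubst σ)
  | or φ ψ, σ => or (φ.msubst σ) (ψ.msubst σ)
  | imp φ ψ, σ => imp (φ.msubst σ) (ψ.msubst σ)
  | neg φ, σ => neg (φ.msubst σ)
  | cons φ, σ => cons (φ.msubst σ)
  | all x φ, σ => all x (φ.msubst (Function.update σ x (.var x)))

theorem msubst_congr (φ : UFormula L) {σ τ : ℕ → L.Term ℕ} (h : ∀ x ∈ φ.freeVars, σ x = τ x) :
    φ.msubst σ = φ.msubst τ := by
  induction φ generalizing σ τ with
  | rel P ts =>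
    simp only [msubst]
    congr 1
    funext i
    exact term_subst_congr _ fun x hx => h x (by simpa [freeVars] using ⟨i, hx⟩)
  | and φ ψ ih₁ ih₂ | or φ ψ ih₁ ih₂ | imp φ ψ ih₁ ih₂ =>
    simp only [msubst]
    rw [ih₁ fun x hx => h x (Finset.mem_union_left _ hx),
      ih₂ fun x hx => h x (Finset.mem_union_right _ hx)]
  | neg φ ih | cons φ ih =>
    simp only [msubst]
    rw [ih h]
  | all x φ ih =>
    simp only [msubst]
    congr 1
    refine ih fun y hy => ?_
    by_cases hyx : y = x
    · simp [hyx]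
    · simpa [hyx] using h y (Finset.mem_erase.2 ⟨hyx, hy⟩)

theorem msubst_var (φ : UFormula L) : φ.msubst Term.var = φ := by
  induction φ with
  | rel P ts => simp only [msubst, term_subst_var]
  | and φ ψ ih₁ ih₂ | or φ ψ ih₁ ih₂ | imp φ ψ ih₁ ih₂ => simp only [msubst, ih₁, ih₂]
  | neg φ ih | cons φ ih => simp only [msubst, ih]
  | all y φ ih => simp only [msubst, Function.update_eq_self, ih]

theorem msubst_of_closed (φ : UFormula L) (h : φ.freeVars = ∅) (σ : ℕ → L.Term ℕ) :
    φ.msubst σ = φ :=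
  (φ.msubst_congr (by simp [h])).trans φ.msubst_var

theorem boundVars_msubst (φ : UFormula L) (σ : ℕ → L.Term ℕ) :
    (φ.msubst σ).boundVars = φ.boundVars := by
  induction φ generalizing σ with
  | rel P ts => rfl
  | and φ ψ ih₁ ih₂ | or φ ψ ih₁ ih₂ | imp φ ψ ih₁ ih₂ => simp only [msubst, boundVars, ih₁, ih₂]
  | neg φ ih | cons φ ih | all y φ ih => simp only [msubst, boundVars, ih]

theorem msubst_msubst (φ : UFormula L) (σ τ : ℕ → L.Term ℕ)
    (h : ∀ y ∈ φ.boundVars, ∀ x ∈ φ.freeVars, x ≠ y → y ∉ (σ x).varFinset) :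
    (φ.msubst σ).msubst τ = φ.msubst fun x => (σ x).subst τ := by
  induction φ generalizing σ τ with
  | rel P ts => simp only [msubst, term_subst_subst]
  | and φ ψ ih₁ ih₂ | or φ ψ ih₁ ih₂ | imp φ ψ ih₁ ih₂ =>
    simp only [boundVars, freeVars, Finset.mem_union] at h
    simp only [msubst]
    rw [ih₁ σ τ fun y hy x hx => h y (.inl hy) x (.inl hx),
      ih₂ σ τ fun y hy x hx => h y (.inr hy) x (.inr hx)]
  | neg φ ih | cons φ ih => simp only [msubst, ih σ τ h]
  | all z φ ih =>
    simp only [boundVars, freeVars, Finset.mem_insert, Finset.mem_erase] at h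
    simp only [msubst]
    rw [ih]
    · congr 1
      refine φ.msubst_congr fun x hx => ?_
      by_cases hxz : x = z
      · simp [hxz]
      · simp only [Function.update_of_ne hxz]
        exact term_subst_congr _ fun y hy => Function.update_of_ne
          (ne_of_mem_of_not_mem hy (h z (.inl rfl) x ⟨hxz, hx⟩ hxz)) _ _
    · intro y hy x hx hxy
      by_cases hxz : x = z
      · simpa [hxz, eq_comm] using hxz ▸ hxy
      · simpa [hxz] using h y (.inr hy) x ⟨hxz, hx⟩ hxy

theorem subst_eq_msubst (φ : UFormula L) (x : ℕ) (t : L.Term ℕ) :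
    φ.subst x t = φ.msubst (Function.update Term.var x t) := by
  induction φ with
  | rel P ts => rfl
  | and φ ψ ih₁ ih₂ | or φ ψ ih₁ ih₂ | imp φ ψ ih₁ ih₂ => simp only [subst, msubst, ih₁, ih₂]
  | neg φ ih | cons φ ih => simp only [subst, msubst, ih]
  | all y φ ih =>
    by_cases hy : y = x
    · simp [subst, msubst, hy, msubst_var]
    · simp [subst, msubst, hy, ih, Function.update_comm (Ne.symm hy)]

theorem subst_var_self (x : ℕ) (φ : UFormula L) : φ.subst x (.var x) = φ := by
  rw [subst_eq_msubst, Function.update_eq_self, msubst_var]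

theorem subst_subst_back {x y : ℕ} (φ : UFormula L) (hf : y ∉ φ.freeVars)
    (hb : y ∉ φ.boundVars) : (φ.subst x (.var y)).subst y (.var x) = φ := by
  rw [subst_eq_msubst, subst_eq_msubst, msubst_msubst]
  · refine (φ.msubst_congr fun z hz => ?_).trans φ.msubst_var
    by_cases hzx : z = x
    · simp [hzx]
    · simp [hzx, ne_of_mem_of_not_mem hz hf]
  · intro z hz w _ hwz
    by_cases hwx : w = x
    · simpa [hwx] using ne_of_mem_of_not_mem hz hb
    · simpa [hwx] using Ne.symm hwz

theorem subst_msubst_update (φ : UFormula L) {σ : ℕ → L.Term ℕ} {x : ℕ} (t : L.Term ℕ)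
    (hx : ∀ y, y ≠ x → x ∉ (σ y).varFinset)
    (hσ : ∀ z ∈ φ.boundVars, ∀ y, z ∉ (σ y).varFinset) :
    (φ.msubst (Function.update σ x (.var x))).subst x t = φ.msubst (Function.update σ x t) := by
  rw [subst_eq_msubst, msubst_msubst]
  · refine φ.msubst_congr fun y _ => ?_
    by_cases hy : y = x
    · simp [hy]
    · simpa [hy] using term_subst_update_of_notMem (hx y hy)
  · intro z hz y _ hyz
    by_cases hy : y = x
    · simpa [hy, eq_comm] using hy ▸ hyz
    · simpa [hy] using hσ z hz y

theorem notMem_freeVars_subst {x : ℕ} {t : L.Term ℕ} (hx : x ∉ t.varFinset) (φ : UFormula L) :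
    x ∉ (φ.subst x t).freeVars := by
  induction φ with
  | rel P ts =>
    simp only [subst, freeVars, Finset.mem_biUnion, Finset.mem_univ, true_and, not_exists]
    refine fun i => notMem_varFinset_subst (fun z => ?_) _
    by_cases hz : z = x
    · simpa [hz] using hx
    · simpa [hz] using Ne.symm hz
  | and φ ψ ih₁ ih₂ | or φ ψ ih₁ ih₂ | imp φ ψ ih₁ ih₂ => simp [subst, freeVars, ih₁, ih₂]
  | neg _ ih | cons _ ih => exact ih
  | all z φ ih =>
    by_cases hz : z = x
    · simp [subst, freeVars, hz]
    · simp [subst, freeVars, hz, ih]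

theorem freeFor_of_notMem {x : ℕ} {t : L.Term ℕ} (φ : UFormula L) (h : x ∉ φ.freeVars) :
    φ.FreeFor x t := by
  induction φ with
  | rel P ts => trivial
  | and φ ψ ih₁ ih₂ | or φ ψ ih₁ ih₂ | imp φ ψ ih₁ ih₂ =>
    exact ⟨ih₁ fun hx => h (Finset.mem_union_left _ hx),
      ih₂ fun hx => h (Finset.mem_union_right _ hx)⟩
  | neg φ ih | cons φ ih => exact ih h
  | all y φ _ => exact Or.inl h

theorem freeFor_var_self (x : ℕ) (φ : UFormula L) : φ.FreeFor x (.var x) := by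
  induction φ with
  | rel _ _ => trivial
  | and φ ψ ih₁ ih₂ | or φ ψ ih₁ ih₂ | imp φ ψ ih₁ ih₂ => exact ⟨ih₁, ih₂⟩
  | neg _ ih | cons _ ih => exact ih
  | all y φ ih =>
    by_cases hy : y = x
    · exact Or.inl (by simp [freeVars, hy])
    · exact Or.inr ⟨by simpa using hy, ih⟩

theorem freeFor_of_disjoint {x : ℕ} {t : L.Term ℕ} (φ : UFormula L)
    (h : ∀ y ∈ φ.boundVars, y ∉ t.varFinset) : φ.FreeFor x t := by
  induction φ with
  | rel P ts => trivial
  | and φ ψ ih₁ ih₂ | or φ ψ ih₁ ih₂ | imp φ ψ ih₁ ih₂ =>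
    exact ⟨ih₁ fun y hy => h y (Finset.mem_union_left _ hy),
      ih₂ fun y hy => h y (Finset.mem_union_right _ hy)⟩
  | neg φ ih | cons φ ih => exact ih h
  | all y φ ih =>
    exact Or.inr ⟨h y (Finset.mem_insert_self _ _),
      ih fun z hz => h z (Finset.mem_insert_of_mem hz)⟩

theorem freeFor_subst_back {x y : ℕ} (φ : UFormula L) (hf : y ∉ φ.freeVars) :
    (φ.subst x (.var y)).FreeFor y (.var x) := by
  induction φ with
  | rel P ts => trivial
  | and φ ψ ih₁ ih₂ | or φ ψ ih₁ ih₂ | imp φ ψ ih₁ ih₂ =>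
    exact ⟨ih₁ fun h => hf (Finset.mem_union_left _ h),
      ih₂ fun h => hf (Finset.mem_union_right _ h)⟩
  | neg φ ih | cons φ ih => exact ih hf
  | all z φ ih =>
    by_cases hz : z = x
    · simp only [subst, hz, if_true]
      exact Or.inl (hz ▸ hf)
    · simp only [subst, hz, if_false]
      by_cases hzy : z = y
      · exact Or.inl (by simp [freeVars, hzy])
      · exact Or.inr ⟨by simpa using hz,
          ih fun h => hf (Finset.mem_erase.2 ⟨Ne.symm hzy, h⟩)⟩

end UFormula

/-! ### Semantics and soundness -/

namespace FourStructure

variable {L : FirstOrder.Language.{u, v}} (A : FourStructure.{u, v, w} L)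

theorem termVal_congr {s s' : ℕ → A.Carrier} (t : L.Term ℕ)
    (h : ∀ x ∈ t.varFinset, s x = s' x) : A.termVal s t = A.termVal s' t := by
  induction t with
  | var x => exact h x (by simp)
  | func f ts ih =>
    simp only [termVal]
    congr 1
    funext i
    exact ih i fun x hx => h x (by simpa using ⟨i, hx⟩)

theorem termVal_subst (s : ℕ → A.Carrier) (σ : ℕ → L.Term ℕ) (t : L.Term ℕ) :
    A.termVal s (t.subst σ) = A.termVal (fun x => A.termVal s (σ x)) t := by
  induction t with
  | var x => rfl
  | func f ts ih => simp only [FirstOrder.Language.Term.subst, termVal, ih]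

theorem val_congr (φ : UFormula L) {s s' : ℕ → A.Carrier} (h : ∀ x ∈ φ.freeVars, s x = s' x) :
    A.val φ.toFormula s = A.val φ.toFormula s' := by
  induction φ generalizing s s' with
  | rel P ts =>
    simp only [UFormula.toFormula, val]
    congr 1
    funext i
    exact A.termVal_congr _ fun x hx => h x (by simpa [UFormula.freeVars] using ⟨i, hx⟩)
  | and φ ψ ih₁ ih₂ | or φ ψ ih₁ ih₂ | imp φ ψ ih₁ ih₂ =>
    simp only [UFormula.toFormula, val]
    rw [ih₁ fun x hx => h x (Finset.mem_union_left _ hx),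
      ih₂ fun x hx => h x (Finset.mem_union_right _ hx)]
  | neg φ ih | cons φ ih =>
    simp only [UFormula.toFormula, val]
    rw [ih h]
  | all x φ ih =>
    simp only [UFormula.toFormula, val]
    refine iInf_congr fun a => ih fun y hy => ?_
    by_cases hyx : y = x
    · simp [hyx]
    · simpa [hyx] using h y (Finset.mem_erase.2 ⟨hyx, hy⟩)

theorem val_update_of_notMem (φ : UFormula L) {x : ℕ} (hx : x ∉ φ.freeVars) (s : ℕ → A.Carrier)
    (a : A.Carrier) : A.val φ.toFormula (Function.update s x a) = A.val φ.toFormula s :=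
  A.val_congr φ fun _ hy => Function.update_of_ne (ne_of_mem_of_not_mem hy hx) _ _

theorem val_subst (x : ℕ) (t : L.Term ℕ) (φ : UFormula L) (h : φ.FreeFor x t)
    (s : ℕ → A.Carrier) :
    A.val (φ.subst x t).toFormula s =
      A.val φ.toFormula (Function.update s x (A.termVal s t)) := by
  induction φ generalizing s with
  | rel P ts =>
    simp only [UFormula.subst, UFormula.toFormula, val, termVal_subst]
    congr 1
    funext i
    congr 1
    funext y
    by_cases hy : y = x
    · simp [hy]
    · simp [hy, termVal]
  | and φ ψ ih₁ ih₂ | or φ ψ ih₁ ih₂ | imp φ ψ ih₁ ih₂ =>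
    simp only [UFormula.subst, UFormula.toFormula, val, ih₁ h.1, ih₂ h.2]
  | neg φ ih | cons φ ih =>
    simp only [UFormula.subst, UFormula.toFormula, val, ih h]
  | all y φ ih =>
    by_cases hyx : y = x
    · simp [UFormula.subst, UFormula.toFormula, val, hyx]
    simp only [UFormula.subst, hyx, if_false, UFormula.toFormula, val]
    refine iInf_congr fun a => ?_
    rcases h with hx | ⟨hy, hφ⟩
    · have hxφ : x ∉ φ.freeVars := fun hx' => hx (Finset.mem_erase.2 ⟨Ne.symm hyx, hx'⟩)
      rw [ih (φ.freeFor_of_notMem hxφ), Function.update_comm (Ne.symm hyx),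
        A.val_update_of_notMem φ hxφ, A.val_update_of_notMem φ hxφ]
    · have ht : A.termVal (Function.update s y a) t = A.termVal s t :=
        A.termVal_congr t fun _ hz => Function.update_of_ne (ne_of_mem_of_not_mem hz hy) _ _
      rw [ih hφ, Function.update_comm hyx, ht]

theorem val_unfoldEx (φ : Formula L) (s : ℕ → A.Carrier) :
    A.val φ.unfoldEx.toFormula s = A.val φ s := by
  induction φ generalizing s with
  | rel P ts => rfl
  | and φ ψ ih₁ ih₂ | or φ ψ ih₁ ih₂ | imp φ ψ ih₁ ih₂ =>
    simp only [Formula.unfoldEx, UFormula.toFormula, val, ih₁, ih₂]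
  | neg φ ih | cons φ ih | all x φ ih =>
    simp only [Formula.unfoldEx, UFormula.toFormula, val, ih]
  | ex x φ ih =>
    simp only [Formula.unfoldEx, UFormula.toFormula, val, ih, Four.neg_iInf, Four.neg_neg]

theorem isModel_unfoldEx (φ : Formula L) : A.IsModel φ.unfoldEx.toFormula ↔ A.IsModel φ := by
  simp only [IsModel, val_unfoldEx]

theorem val_mem_designated_of_hilbertAx {φ : UFormula L} (h : HilbertAx φ) (s : ℕ → A.Carrier) :
    A.val φ.toFormula s ∈ Four.designated := by
  cases h with
  | allA x t φ h =>
    simp only [UFormula.toFormula, val, Four.imp_mem_designated, Four.iInf_mem_designated,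
      A.val_subst x t φ h]
    exact fun hall => hall _
  | allB x φ =>
    simp only [UFormula.toFormula, val, Four.imp_mem_designated, Four.neg_neg, imp_self]
  | allC x t φ h =>
    simp only [UFormula.toFormula, val, Four.imp_mem_designated, Four.neg_iInf,
      Four.iSup_mem_designated, A.val_subst x t φ h]
    exact fun hneg => ⟨_, hneg⟩
  | _ =>
    simp only [UFormula.toFormula, UFormula.iff, val, Four.imp_mem_designated,
      Four.and_mem_designated, Four.or_mem_designated, Four.cons_mem_designated, Four.neg_neg,
      Four.neg_and, Four.neg_or, Four.neg_imp_mem_designated, Four.neg_cons_mem_designated]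
    grind

theorem isModel_of_derivable {Δ : Set (UFormula L)} {φ : UFormula L} (h : Derivable Δ φ)
    (hA : ∀ δ ∈ Δ, A.IsModel δ.toFormula) : A.IsModel φ.toFormula := by
  induction h with
  | hyp h => exact hA _ h
  | ax h => exact A.val_mem_designated_of_hilbertAx h
  | mp _ _ ih₁ ih₂ => exact fun s => Four.imp_mem_designated.1 (ih₁ s) (ih₂ s)
  | @allIn1 α β x hx _ ih =>
    intro s
    simp only [UFormula.toFormula, val, IsModel, Four.imp_mem_designated,
      Four.iInf_mem_designated] at ih ⊢
    exact fun hα a => ih _ ((A.val_update_of_notMem α hx s a).symm ▸ hα)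
  | @allIn2 α β x hx _ ih =>
    intro s
    simp only [UFormula.toFormula, val, IsModel, Four.imp_mem_designated, Four.neg_iInf,
      Four.neg_neg, Four.iSup_mem_designated] at ih ⊢
    rintro ⟨a, ha⟩
    exact A.val_update_of_notMem α hx s a ▸ ih _ ha

end FourStructure

/-! ### Ultraproducts and compactness -/

section Ultrafilters

variable {ι : Type*} (U : Ultrafilter ι)

theorem exists_eventually_eq {V : Type*} [Finite V] (f : ι → V) : ∃ v, ∀ᶠ i in U, f i = v := by
  obtain ⟨v, hv⟩ := (U.map f).eq_pure_of_finite
  have : {v} ∈ U.map f := hv ▸ Set.mem_singleton v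
  exact ⟨v, Ultrafilter.mem_map.1 this⟩

variable {U} in
theorem eventually_range_eq {V : Type*} [Finite V] {M : ι → Type*} [∀ i, Nonempty (M i)]
    {f : ∀ i, M i → V} {g : (∀ i, M i) → V} (h : ∀ c, ∀ᶠ i in U, f i (c i) = g c) :
    ∀ᶠ i in U, Set.range (f i) = Set.range g := by
  have mem_range_iff (v : V) : v ∈ Set.range g ↔ ∀ᶠ i in U, v ∈ Set.range (f i) := by
    simp only [Set.mem_range, Filter.skolem]
    refine exists_congr fun c => ⟨fun hc => hc ▸ h c, fun hc => ?_⟩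
    obtain ⟨i, hi, hi'⟩ := ((h c).and hc).exists
    exact hi.symm.trans hi'
  have (v : V) : ∀ᶠ i in U, v ∈ Set.range (f i) ↔ v ∈ Set.range g := by
    by_cases hv : v ∈ Set.range g
    · simpa only [hv, iff_true] using (mem_range_iff v).1 hv
    · simpa only [hv, iff_false] using U.eventually_not.2 (mt (mem_range_iff v).2 hv)
  exact (Filter.eventually_all.2 this).mono fun _ => Set.ext

end Ultrafilters

namespace FourStructure

variable {L : FirstOrder.Language.{u, v}} {ι : Type w'} (U : Ultrafilter ι)
  (A : ι → FourStructure.{u, v, w} L)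

/-- The ultraproduct of `4`-structures. Since `L` has no equality symbol, the product of the
carriers need not be divided by the ultrafilter. -/
noncomputable def ultraproduct : FourStructure.{u, v, max w' w} L where
  Carrier := ∀ i, (A i).Carrier
  nonempty := ⟨fun i => (A i).nonempty.some⟩
  relMap P c := (exists_eventually_eq U fun i => (A i).relMap P fun j => c j i).choose
  funMap f c := fun i => (A i).funMap f fun j => c j i

theorem termVal_ultraproduct (s : ℕ → (ultraproduct U A).Carrier) (t : L.Term ℕ) (i : ι) :
    (ultraproduct U A).termVal s t i = (A i).termVal (fun x => s x i) t := by
  induction t with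
  | var x => rfl
  | func f ts ih => simp only [termVal, ultraproduct, ← ih]

theorem eval_update (s : ℕ → (ultraproduct U A).Carrier) (x : ℕ) (c : (ultraproduct U A).Carrier)
    (i : ι) : (fun y => Function.update s x c y i) = Function.update (fun y => s y i) x (c i) :=
  funext fun y => by by_cases hy : y = x <;> simp [hy]

theorem eventually_val_eq (φ : Formula L) (s : ℕ → (ultraproduct U A).Carrier) :
    ∀ᶠ i in U, (A i).val φ (fun x => s x i) = (ultraproduct U A).val φ s := by
  have := fun i => (A i).nonempty
  induction φ generalizing s with
  | rel P ts =>
    simp only [val, ← termVal_ultraproduct]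
    exact (exists_eventually_eq U _).choose_spec
  | and φ ψ ih₁ ih₂ | or φ ψ ih₁ ih₂ | imp φ ψ ih₁ ih₂ =>
    filter_upwards [ih₁ s, ih₂ s] with i h₁ h₂
    simp only [val, h₁, h₂]
  | neg φ ih | cons φ ih =>
    filter_upwards [ih s] with i h
    simp only [val, h]
  | all x φ ih | ex x φ ih =>
    have hrange := eventually_range_eq (U := U)
      (f := fun i a => (A i).val φ (Function.update (fun y => s y i) x a))
      (g := fun c => (ultraproduct U A).val φ (Function.update s x c))
      fun c => (ih (Function.update s x c)).mono fun i hi => eval_update U A s x c i ▸ hi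
    filter_upwards [hrange] with i h
    exact congrArg _ h

theorem isModel_ultraproduct_iff (φ : Formula L) :
    (ultraproduct U A).IsModel φ ↔ ∀ᶠ i in U, (A i).IsModel φ := by
  have := fun i => (A i).nonempty
  constructor
  · contrapose
    rw [← U.eventually_not]
    intro h
    simp only [IsModel, not_forall, Filter.skolem] at h
    obtain ⟨s, hs⟩ := h
    obtain ⟨i, hi, hval⟩ := (hs.and (eventually_val_eq U A φ fun x i => s i x)).exists
    exact fun hA => hi (hval ▸ hA _)
  · intro h s
    obtain ⟨i, hi, hval⟩ := (h.and (eventually_val_eq U A φ s)).exists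
    exact hval ▸ hi _

/-- Compactness, in the form appropriate for consequence: the refuted formula stays fixed. -/
theorem exists_isModel_of_forall_finset {κ : Type w'} (δ : κ → Formula L) (φ : Formula L)
    (h : ∀ I : Finset κ, ∃ A : FourStructure.{u, v, w} L,
      (∀ k ∈ I, A.IsModel (δ k)) ∧ ¬A.IsModel φ) :
    ∃ A : FourStructure.{u, v, max w' w} L, (∀ k, A.IsModel (δ k)) ∧ ¬A.IsModel φ := by
  classical
  choose A hδ hφ using h
  let U : Ultrafilter (Finset κ) := Ultrafilter.of Filter.atTop
  refine ⟨ultraproduct U A, fun k => ?_, ?_⟩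
  · rw [isModel_ultraproduct_iff]
    have : ∀ᶠ I in (U : Filter (Finset κ)), {k} ≤ I :=
      (Filter.eventually_ge_atTop {k}).filter_mono (Ultrafilter.of_le _)
    exact this.mono fun I hI => hδ I k (Finset.singleton_subset_iff.1 hI)
  · rw [isModel_ultraproduct_iff, ← U.eventually_not]
    exact Filter.Eventually.of_forall hφ

end FourStructure

/-! ### Derived rules -/

/-- The classical negation of `α`: being explosive over `α`, it expresses that `α` is not
designated, in contrast to the paraconsistent `¬`. -/
def UFormula.strongNeg {L : FirstOrder.Language.{u, v}} (α : UFormula L) : UFormula L :=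
  α.imp (α.cons.and (α.and α.neg))

theorem UFormula.freeVars_strongNeg {L : FirstOrder.Language.{u, v}} (α : UFormula L) :
    α.strongNeg.freeVars = α.freeVars := by
  simp [strongNeg, freeVars]

namespace Derivable

variable {L : FirstOrder.Language.{u, v}} {Δ : Set (UFormula L)} {α β γ ψ : UFormula L} {x y : ℕ}

theorem trans_hyp {Δ' : Set (UFormula L)} (h : Derivable Δ α) (hΔ : ∀ δ ∈ Δ, Derivable Δ' δ) :
    Derivable Δ' α := by
  induction h with
  | hyp h => exact hΔ _ h
  | ax h => exact ax h
  | mp _ _ ih₁ ih₂ => exact mp ih₁ ih₂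
  | allIn1 x hx _ ih => exact allIn1 x hx ih
  | allIn2 x hx _ ih => exact allIn2 x hx ih

theorem weaken (h : Derivable Δ α) : Derivable Δ (γ.imp α) :=
  mp (ax (.pos1 _ _)) h

theorem imp_mp (h₁ : Derivable Δ (γ.imp (α.imp β))) (h₂ : Derivable Δ (γ.imp α)) :
    Derivable Δ (γ.imp β) :=
  mp (mp (ax (.pos2 _ _ _)) h₁) h₂

theorem imp_refl : Derivable Δ (α.imp α) :=
  imp_mp (β := α) (α := α.imp α) (ax (.pos1 _ _)) (ax (.pos1 _ _))

theorem imp_trans (h₁ : Derivable Δ (α.imp β)) (h₂ : Derivable Δ (β.imp γ)) :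
    Derivable Δ (α.imp γ) :=
  imp_mp h₂.weaken h₁

theorem imp_and (h₁ : Derivable Δ (γ.imp α)) (h₂ : Derivable Δ (γ.imp β)) :
    Derivable Δ (γ.imp (α.and β)) :=
  imp_mp (imp_mp (ax (.pos5 _ _)).weaken h₁) h₂

theorem curry (h : Derivable Δ ((α.and β).imp γ)) : Derivable Δ (α.imp (β.imp γ)) :=
  imp_trans (ax (.pos5 _ _)) (mp (ax (.pos2 _ _ _)) h.weaken)

theorem uncurry (h : Derivable Δ (α.imp (β.imp γ))) : Derivable Δ ((α.and β).imp γ) :=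
  imp_mp (imp_trans (ax (.pos3 _ _)) h) (ax (.pos4 _ _))

theorem swap (h : Derivable Δ (α.imp (β.imp γ))) : Derivable Δ (β.imp (α.imp γ)) :=
  curry (imp_trans (imp_and (ax (.pos4 _ _)) (ax (.pos3 _ _))) (uncurry h))

theorem imp_cases (h₁ : Derivable Δ (α.imp γ)) (h₂ : Derivable Δ (β.imp γ)) :
    Derivable Δ ((α.or β).imp γ) :=
  mp (mp (ax (.pos8 _ _ _)) h₁) h₂

theorem strongNeg_imp : Derivable Δ (α.strongNeg.imp (α.imp β)) :=
  mp (ax (.pos2 _ _ _)) (ax (.cons1 α β)).weaken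

theorem of_imp_of_strongNeg_imp (h₁ : Derivable Δ (α.imp β))
    (h₂ : Derivable Δ (α.strongNeg.imp β)) : Derivable Δ β :=
  mp (imp_cases h₁ h₂) (ax (.pos9 _ _))

theorem imp_strongNeg_swap (h : Derivable Δ (α.imp β.strongNeg)) :
    Derivable Δ (β.imp α.strongNeg) :=
  of_imp_of_strongNeg_imp (imp_trans h strongNeg_imp) (ax (.pos1 _ _))

theorem generalize (x : ℕ) (h : Derivable Δ α) : Derivable Δ (α.all x) := by
  have hx : x ∉ ((α.all x).imp (α.all x)).freeVars := by simp [UFormula.freeVars]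
  exact mp (allIn1 x hx h.weaken) imp_refl

theorem of_all (h : Derivable Δ (α.all x)) : Derivable Δ α := by
  have := mp (ax (.allA x (.var x) α (α.freeFor_var_self x))) h
  rwa [α.subst_var_self] at this

theorem neg_all_imp (hx : x ∉ α.freeVars) (h : Derivable Δ (β.neg.imp α)) :
    Derivable Δ ((β.all x).neg.imp α) :=
  imp_trans (ax (.allB x β)) (allIn2 x hx h)

theorem imp_all_of_fresh (hα : y ∉ α.freeVars) (hxy : x ≠ y) (hf : y ∉ ψ.freeVars)
    (hb : y ∉ ψ.boundVars) (h : Derivable Δ (α.imp (ψ.subst x (.var y)))) :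
    Derivable Δ (α.imp (ψ.all x)) := by
  have hx : x ∉ (ψ.subst x (.var y)).freeVars := ψ.notMem_freeVars_subst (by simpa using hxy)
  refine imp_trans (allIn1 y hα h) (allIn1 x (mt Finset.mem_of_mem_erase hx) ?_)
  have := ax (Γ := Δ) (.allA y (.var x) _ (ψ.freeFor_subst_back (x := x) hf))
  rwa [ψ.subst_subst_back hf hb] at this

theorem neg_all_imp_of_fresh (hα : y ∉ α.freeVars) (hxy : x ≠ y) (hf : y ∉ ψ.freeVars)
    (hb : y ∉ ψ.boundVars) (h : Derivable Δ ((ψ.subst x (.var y)).neg.imp α)) :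
    Derivable Δ ((ψ.all x).neg.imp α) := by
  have hx : x ∉ (ψ.subst x (.var y)).freeVars := ψ.notMem_freeVars_subst (by simpa using hxy)
  refine imp_trans (neg_all_imp (x := x) (mt (Finset.mem_of_mem_erase (a := y)) hx) ?_)
    (neg_all_imp hα h)
  have := ax (Γ := Δ) (.allC y (.var x) _ (ψ.freeFor_subst_back (x := x) hf))
  rwa [ψ.subst_subst_back hf hb] at this

end Derivable

/-! ### Universal closure -/

namespace UFormula

variable {L : FirstOrder.Language.{u, v}}

/-- Universal quantification over the variables `0, …, m - 1`, with which the universal closure is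
built. -/
def allBelow (φ : UFormula L) : ℕ → UFormula L
  | 0 => φ
  | m + 1 => (φ.allBelow m).all m

/-- The universal closure of a formula. It may have vacuous quantifiers, since all variables up to
the greatest free one are quantified. -/
def close (φ : UFormula L) : UFormula L := φ.allBelow (φ.freeVars.sup Nat.succ)

theorem freeVars_allBelow (φ : UFormula L) (m : ℕ) :
    (φ.allBelow m).freeVars = φ.freeVars.filter (m ≤ ·) := by
  induction m with
  | zero => simp [allBelow]
  | succ m ih =>
    ext x
    simp only [allBelow, freeVars, ih, Finset.mem_erase, Finset.mem_filter]
    grind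

theorem freeVars_close (φ : UFormula L) : φ.close.freeVars = ∅ := by
  rw [close, freeVars_allBelow, Finset.filter_eq_empty_iff]
  exact fun x hx => Nat.not_le.2 (Finset.le_sup (f := Nat.succ) hx)

theorem derivable_close_iff {Δ : Set (UFormula L)} (φ : UFormula L) :
    Derivable Δ φ.close ↔ Derivable Δ φ := by
  rw [close]
  induction φ.freeVars.sup Nat.succ with
  | zero => rfl
  | succ m ih => exact ⟨fun h => ih.1 h.of_all, fun h => (ih.2 h).generalize m⟩

end UFormula

theorem FourStructure.isModel_close_iff {L : FirstOrder.Language.{u, v}}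
    (A : FourStructure.{u, v, w} L) (φ : UFormula L) :
    A.IsModel φ.close.toFormula ↔ A.IsModel φ.toFormula := by
  rw [UFormula.close]
  induction φ.freeVars.sup Nat.succ with
  | zero => rfl
  | succ m ih =>
    rw [← ih]
    simp only [IsModel, UFormula.allBelow, UFormula.toFormula, val, Four.iInf_mem_designated]
    refine ⟨fun h s => ?_, fun h s a => h _⟩
    simpa only [Function.update_eq_self] using h s (s m)

/-! ### Henkin theories for countably many formulas -/

section Theories

variable {L : FirstOrder.Language.{u, v}} {Δ S T : Set (UFormula L)} {W : Set (L.Term ℕ)}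
  {α β γ : UFormula L}

/-- The formula `γ` is consistent over `Δ`: it does not imply every formula. -/
def Consistent (Δ : Set (UFormula L)) (γ : UFormula L) : Prop :=
  ∃ β, ¬Derivable Δ (γ.imp β)

theorem not_consistent_of_imp_strongNeg (h : Derivable Δ (γ.imp α))
    (h' : Derivable Δ (γ.imp α.strongNeg)) : ¬Consistent Δ γ :=
  fun ⟨_, hβ⟩ => hβ ((h'.imp_trans .strongNeg_imp).imp_mp h)

theorem imp_strongNeg_of_not_consistent_and (h : ¬Consistent Δ (γ.and α)) :
    Derivable Δ (γ.imp α.strongNeg) :=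
  .curry (not_not.1 (not_exists.1 h _))

theorem imp_of_not_consistent_and_strongNeg (h : ¬Consistent Δ (γ.and α.strongNeg)) :
    Derivable Δ (γ.imp α) :=
  .of_imp_of_strongNeg_imp (.ax (.pos1 α γ)) (.swap (.curry (not_not.1 (not_exists.1 h _))))

theorem consistent_strongNeg_of_not_derivable (h : ¬Derivable Δ α) :
    Consistent Δ α.strongNeg :=
  ⟨α, fun h' => h (.of_imp_of_strongNeg_imp .imp_refl h')⟩

/-- A set of formulas is dense over `Δ` if every consistent formula stays consistent with some
formula of the set; this is density in the Boolean algebra of formulas modulo `Δ`. -/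
def IsDense (Δ A : Set (UFormula L)) : Prop :=
  ∀ γ, Consistent Δ γ → ∃ α ∈ A, Consistent Δ (γ.and α)

/-- `T` is a consistent deductively closed set of formulas that contains the theorems of `Δ`. Since
`T` may contain variables as parameters, it is closed under modus ponens only. -/
structure IsTheory (Δ T : Set (UFormula L)) : Prop where
  of_derivable : ∀ {α}, Derivable Δ α → α ∈ T
  mp : ∀ {α β : UFormula L}, α.imp β ∈ T → α ∈ T → β ∈ T
  strongNeg_notMem : ∀ {α}, α ∈ T → α.strongNeg ∉ T

/-- The Rasiowa–Sikorski lemma. -/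
theorem exists_isTheory_meeting {𝒜 : Set (Set (UFormula L))} (h𝒜 : 𝒜.Countable)
    (hdense : ∀ A ∈ 𝒜, IsDense Δ A) (hγ : Consistent Δ γ) :
    ∃ T, IsTheory Δ T ∧ γ ∈ T ∧ ∀ A ∈ 𝒜, ∃ α ∈ A, α ∈ T := by
  let : Preorder {γ // Consistent Δ γ} :=
    { le := fun γ δ => Derivable Δ (δ.1.imp γ.1)
      le_refl := fun _ => .imp_refl
      le_trans := fun _ _ _ h₁ h₂ => h₂.imp_trans h₁ }
  let : Encodable 𝒜 := h𝒜.toEncodable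
  let 𝒟 (A : 𝒜) : Order.Cofinal {γ // Consistent Δ γ} :=
    { carrier := {γ | ∃ α ∈ A.1, Derivable Δ (γ.1.imp α)}
      isCofinal := fun γ => by
        obtain ⟨α, hα, hγα⟩ := hdense A A.2 γ.1 γ.2
        exact ⟨⟨γ.1.and α, hγα⟩, ⟨α, hα, .ax (.pos4 _ _)⟩, .ax (.pos3 _ _)⟩ }
  let I := Order.idealOfCofinals ⟨γ, hγ⟩ 𝒟
  have hγI : ⟨γ, hγ⟩ ∈ I := Order.mem_idealOfCofinals _ _
  have mp {α β : UFormula L} (h₁ : ∃ δ ∈ I, Derivable Δ (δ.1.imp (α.imp β)))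
      (h₂ : ∃ δ ∈ I, Derivable Δ (δ.1.imp α)) : ∃ δ ∈ I, Derivable Δ (δ.1.imp β) := by
    obtain ⟨δ₁, hI₁, h₁⟩ := h₁
    obtain ⟨δ₂, hI₂, h₂⟩ := h₂
    obtain ⟨δ, hI, hδ₁, hδ₂⟩ := I.directed δ₁ hI₁ δ₂ hI₂
    exact ⟨δ, hI, .imp_mp (.imp_trans hδ₁ h₁) (.imp_trans hδ₂ h₂)⟩
  refine ⟨{α | ∃ δ ∈ I, Derivable Δ (δ.1.imp α)}, ⟨fun h => ⟨_, hγI, h.weaken⟩, mp, ?_⟩,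
    ⟨_, hγI, .imp_refl⟩, fun A hA => ?_⟩
  · intro α hα hα'
    obtain ⟨δ, -, hδ⟩ := mp hα' hα
    exact not_consistent_of_imp_strongNeg hδ (.imp_trans hδ (.ax (.cons1 α _))) δ.2
  · obtain ⟨δ, ⟨α, hα, hδα⟩, hI⟩ := Order.cofinal_meets_idealOfCofinals ⟨γ, hγ⟩ 𝒟 ⟨A, hA⟩
    exact ⟨α, hα, δ, hI, hδα⟩

theorem isDense_pair_strongNeg (α : UFormula L) : IsDense Δ {α, α.strongNeg} := by
  intro γ hγ
  by_contra! h
  exact not_consistent_of_imp_strongNeg (imp_of_not_consistent_and_strongNeg (h _ (.inr rfl)))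
    (imp_strongNeg_of_not_consistent_and (h _ (.inl rfl))) hγ

theorem exists_var_mem_fresh (hW : ∃ᶠ n in Filter.atTop, .var n ∈ W) (x : ℕ) (γ ψ : UFormula L) :
    ∃ y, .var y ∈ W ∧ y ∉ γ.freeVars ∧ x ≠ y ∧ y ∉ ψ.freeVars ∧ y ∉ ψ.boundVars := by
  have hfresh : ∀ᶠ y in Filter.atTop, y ∉ insert x (γ.freeVars ∪ ψ.freeVars ∪ ψ.boundVars) :=
    Nat.cofinite_eq_atTop ▸ Finset.eventually_cofinite_notMem _
  obtain ⟨y, hy, hyV⟩ := (hW.and_eventually hfresh).exists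
  grind

theorem isDense_insert_all (hW : ∃ᶠ n in Filter.atTop, .var n ∈ W) (x : ℕ) (ψ : UFormula L) :
    IsDense Δ (insert (ψ.all x) ((fun t => (ψ.subst x t).strongNeg) '' W)) := by
  intro γ hγ
  by_contra! h
  obtain ⟨y, hyW, hyγ, hxy, hf, hb⟩ := exists_var_mem_fresh hW x γ ψ
  have hψ := imp_of_not_consistent_and_strongNeg (h _ (.inr ⟨_, hyW, rfl⟩))
  exact not_consistent_of_imp_strongNeg (.imp_all_of_fresh hyγ hxy hf hb hψ)
    (imp_strongNeg_of_not_consistent_and (h _ (.inl rfl))) hγ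

theorem isDense_insert_strongNeg_neg_all (hW : ∃ᶠ n in Filter.atTop, .var n ∈ W) (x : ℕ)
    (ψ : UFormula L) :
    IsDense Δ (insert (ψ.all x).neg.strongNeg ((fun t => (ψ.subst x t).neg) '' W)) := by
  intro γ hγ
  by_contra! h
  obtain ⟨y, hyW, hyγ, hxy, hf, hb⟩ := exists_var_mem_fresh hW x γ ψ
  have hψ := (imp_strongNeg_of_not_consistent_and (h _ (.inr ⟨_, hyW, rfl⟩))).imp_strongNeg_swap
  have hall := Derivable.neg_all_imp_of_fresh (by rwa [γ.freeVars_strongNeg]) hxy hf hb hψ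
  exact not_consistent_of_imp_strongNeg (imp_of_not_consistent_and_strongNeg (h _ (.inl rfl)))
    hall.imp_strongNeg_swap hγ

/-- `T` contains `α` or its classical negation. -/
def Decides (T : Set (UFormula L)) (α : UFormula L) : Prop :=
  α ∈ T ∨ α.strongNeg ∈ T

/-- A theory that decides the formulas of `S` and their negations and has witnesses in `W` for the
universally quantified formulas of `S` and their negations. The parameter `S` serves to restrict
these requirements to countably many, as Rasiowa–Sikorski demands. -/
structure IsHenkin (Δ S : Set (UFormula L)) (W : Set (L.Term ℕ)) (T : Set (UFormula L)) : Prop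
    extends IsTheory Δ T where
  decides : ∀ α ∈ S, Decides T α
  decides_neg : ∀ α ∈ S, Decides T α.neg
  witness : ∀ x ψ, UFormula.all x ψ ∈ S →
    UFormula.all x ψ ∈ T ∨ ∃ t ∈ W, (ψ.subst x t).strongNeg ∈ T
  neg_witness : ∀ x ψ, UFormula.all x ψ ∈ S →
    (UFormula.all x ψ).neg.strongNeg ∈ T ∨ ∃ t ∈ W, (ψ.subst x t).neg ∈ T

theorem exists_isHenkin (hS : S.Countable) (hW : ∃ᶠ n in Filter.atTop, .var n ∈ W)
    (hγ : Consistent Δ γ) : ∃ T, IsHenkin Δ S W T ∧ γ ∈ T := by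
  let univ (p : ℕ × UFormula L) : UFormula L := p.2.all p.1
  have hU : (univ ⁻¹' S).Countable :=
    hS.preimage fun p q hpq => by simpa [univ, Prod.ext_iff] using hpq
  let inst (p : ℕ × UFormula L) (t : L.Term ℕ) : UFormula L := p.2.subst p.1 t
  obtain ⟨T, hT, hγT, hmeet⟩ := exists_isTheory_meeting (Δ := Δ) (γ := γ)
    (𝒜 := (fun α => {α, α.strongNeg}) '' S ∪ (fun α => {α.neg, α.neg.strongNeg}) '' S ∪
      (fun p => insert (univ p) ((fun t => (inst p t).strongNeg) '' W)) '' (univ ⁻¹' S) ∪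
      (fun p => insert (univ p).neg.strongNeg ((fun t => (inst p t).neg) '' W)) '' (univ ⁻¹' S))
    (.union (.union (.union (hS.image _) (hS.image _)) (hU.image _)) (hU.image _))
    (by
      rintro _ (((⟨α, -, rfl⟩ | ⟨α, -, rfl⟩) | ⟨p, -, rfl⟩) | ⟨p, -, rfl⟩)
      · exact isDense_pair_strongNeg α
      · exact isDense_pair_strongNeg α.neg
      · exact isDense_insert_all hW p.1 p.2
      · exact isDense_insert_strongNeg_neg_all hW p.1 p.2) hγ
  refine ⟨T, ⟨hT, fun α hα => ?_, fun α hα => ?_, fun x ψ hψ => ?_, fun x ψ hψ => ?_⟩, hγT⟩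
  · simpa [Decides] using hmeet _ (.inl (.inl (.inl ⟨α, hα, rfl⟩)))
  · simpa [Decides] using hmeet _ (.inl (.inl (.inr ⟨α, hα, rfl⟩)))
  · simpa [univ, inst] using hmeet _ (.inl (.inr ⟨(x, ψ), hψ, rfl⟩))
  · simpa [univ, inst] using hmeet _ (.inr ⟨(x, ψ), hψ, rfl⟩)

end Theories

/-! ### Theories as valuations -/

section Valuations

variable {L : FirstOrder.Language.{u, v}} {Δ S T : Set (UFormula L)} {W : Set (L.Term ℕ)}
  {α β γ : UFormula L}

namespace IsTheory

theorem mem_of_ax_imp (hT : IsTheory Δ T) (h : HilbertAx (α.imp β)) (hα : α ∈ T) : β ∈ T :=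
  hT.mp (hT.of_derivable (.ax h)) hα

theorem imp_mem_of_strongNeg_mem (hT : IsTheory Δ T) (h : α.strongNeg ∈ T) : α.imp β ∈ T :=
  hT.mp (hT.of_derivable .strongNeg_imp) h

theorem mem_of_or_mem (hT : IsTheory Δ T) (h : α.or β ∈ T) (hα : α.imp γ ∈ T)
    (hβ : β.imp γ ∈ T) : γ ∈ T :=
  hT.mp (hT.mp (hT.mem_of_ax_imp (.pos8 _ _ _) hα) hβ) h

theorem and_mem_iff (hT : IsTheory Δ T) : α.and β ∈ T ↔ α ∈ T ∧ β ∈ T :=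
  ⟨fun h => ⟨hT.mem_of_ax_imp (.pos3 _ _) h, hT.mem_of_ax_imp (.pos4 _ _) h⟩,
    fun h => hT.mp (hT.mem_of_ax_imp (.pos5 _ _) h.1) h.2⟩

theorem mem_iff_of_ax_iff (hT : IsTheory Δ T) (h : HilbertAx (α.iff β)) : α ∈ T ↔ β ∈ T :=
  have h' := hT.and_mem_iff.1 (hT.of_derivable (.ax h))
  ⟨hT.mp h'.1, hT.mp h'.2⟩

theorem or_mem_iff (hT : IsTheory Δ T) (hα : Decides T α) : α.or β ∈ T ↔ α ∈ T ∨ β ∈ T := by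
  refine ⟨fun h => hα.imp_right fun hn => ?_, ?_⟩
  · exact hT.mem_of_or_mem h (hT.imp_mem_of_strongNeg_mem hn) (hT.of_derivable .imp_refl)
  · rintro (h | h)
    · exact hT.mem_of_ax_imp (.pos6 _ _) h
    · exact hT.mem_of_ax_imp (.pos7 _ _) h

theorem imp_mem_iff (hT : IsTheory Δ T) (hα : Decides T α) :
    α.imp β ∈ T ↔ (α ∈ T → β ∈ T) := by
  refine ⟨hT.mp, fun h => ?_⟩
  rcases hα with hα | hα
  · exact hT.mem_of_ax_imp (.pos1 _ _) (h hα)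
  · exact hT.imp_mem_of_strongNeg_mem hα

theorem cons_mem_iff (hT : IsTheory Δ T) (hα : Decides T α) (hn : Decides T α.neg) :
    α.cons ∈ T ↔ ¬(α ∈ T ∧ α.neg ∈ T) := by
  constructor
  · rintro h ⟨h₁, h₂⟩
    exact hT.strongNeg_notMem h₁
      (hT.mem_of_ax_imp (.cons1 α _) (hT.and_mem_iff.2 ⟨h, hT.and_mem_iff.2 ⟨h₁, h₂⟩⟩))
  · intro h
    have imp_cons {β : UFormula L} (hβ : Derivable Δ ((α.and α.neg).imp β))
        (hβ' : β.strongNeg ∈ T) : (α.and α.neg).imp α.cons ∈ T :=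
      hT.mp (hT.of_derivable (.swap (.imp_trans hβ (.swap .strongNeg_imp)))) hβ'
    refine hT.mem_of_or_mem (hT.of_derivable (.ax (.cons2 α))) (hT.of_derivable .imp_refl) ?_
    rcases hα with h₁ | h₁
    · rcases hn with h₂ | h₂
      · exact absurd ⟨h₁, h₂⟩ h
      · exact imp_cons (.ax (.pos4 _ _)) h₂
    · exact imp_cons (.ax (.pos3 _ _)) h₁

end IsTheory

/-- The truth value that a theory assigns to a formula: `α` is at least true if it belongs to `T`,
and at least false if its negation does. -/
noncomputable def value (T : Set (UFormula L)) (α : UFormula L) : Four :=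
  .ofDesignated (α ∈ T) (α.neg ∈ T)

theorem value_mem_designated : value T α ∈ Four.designated ↔ α ∈ T :=
  Four.ofDesignated_mem_designated

theorem neg_value_mem_designated : (value T α).neg ∈ Four.designated ↔ α.neg ∈ T :=
  Four.neg_ofDesignated_mem_designated

namespace IsTheory

theorem value_neg (hT : IsTheory Δ T) (α : UFormula L) : value T α.neg = (value T α).neg := by
  apply Four.ext_designated <;>
    simp only [Four.neg_neg, value_mem_designated, neg_value_mem_designated,
      hT.mem_iff_of_ax_iff (.dneg _)]

theorem value_and (hT : IsTheory Δ T) (hα : Decides T α.neg) :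
    value T (α.and β) = (value T α).and (value T β) := by
  apply Four.ext_designated <;>
    simp only [Four.neg_and, Four.and_mem_designated, Four.or_mem_designated,
      value_mem_designated, neg_value_mem_designated, hT.mem_iff_of_ax_iff (.dm2 _ _),
      hT.and_mem_iff, hT.or_mem_iff hα]

theorem value_or (hT : IsTheory Δ T) (hα : Decides T α) :
    value T (α.or β) = (value T α).or (value T β) := by
  apply Four.ext_designated <;>
    simp only [Four.neg_or, Four.and_mem_designated, Four.or_mem_designated,
      value_mem_designated, neg_value_mem_designated, hT.mem_iff_of_ax_iff (.dm1 _ _),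
      hT.and_mem_iff, hT.or_mem_iff hα]

theorem value_imp (hT : IsTheory Δ T) (hα : Decides T α) (hn : Decides T α.neg) :
    value T (α.imp β) = (value T α).imp (value T β) := by
  apply Four.ext_designated <;>
    simp only [Four.imp_mem_designated, Four.neg_imp_mem_designated, value_mem_designated,
      neg_value_mem_designated, hT.mem_iff_of_ax_iff (.dm3 _ _), hT.and_mem_iff,
      hT.imp_mem_iff hα, hT.imp_mem_iff hn]

theorem value_cons (hT : IsTheory Δ T) (hα : Decides T α) (hn : Decides T α.neg) :
    value T α.cons = (value T α).cons := by
  apply Four.ext_designated <;>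
    simp only [Four.cons_mem_designated, Four.neg_cons_mem_designated, value_mem_designated,
      neg_value_mem_designated, hT.cons_mem_iff hα hn, hT.mem_iff_of_ax_iff (.cons3 _),
      UFormula.iff, hT.and_mem_iff, hT.imp_mem_iff hα, hT.imp_mem_iff hn,
      iff_iff_implies_and_implies]

end IsTheory

namespace IsHenkin

variable {x : ℕ} {ψ : UFormula L}

theorem all_mem_iff (hT : IsHenkin Δ S W T) (hψ : ψ.all x ∈ S)
    (hfree : ∀ t ∈ W, ψ.FreeFor x t) : ψ.all x ∈ T ↔ ∀ t ∈ W, ψ.subst x t ∈ T := by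
  refine ⟨fun h t ht => hT.mem_of_ax_imp (.allA x t ψ (hfree t ht)) h, fun h => ?_⟩
  refine (hT.witness x ψ hψ).resolve_right ?_
  rintro ⟨t, ht, hn⟩
  exact hT.strongNeg_notMem (h t ht) hn

theorem neg_all_mem_iff (hT : IsHenkin Δ S W T) (hψ : ψ.all x ∈ S)
    (hfree : ∀ t ∈ W, ψ.FreeFor x t) :
    (ψ.all x).neg ∈ T ↔ ∃ t ∈ W, (ψ.subst x t).neg ∈ T := by
  refine ⟨fun h => ?_, ?_⟩
  · exact (hT.neg_witness x ψ hψ).resolve_left (hT.strongNeg_notMem h)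
  · rintro ⟨t, ht, h⟩
    exact hT.mem_of_ax_imp (.allC x t ψ (hfree t ht)) h

theorem value_all (hT : IsHenkin Δ S W T) (hψ : ψ.all x ∈ S) (hfree : ∀ t ∈ W, ψ.FreeFor x t) :
    value T (ψ.all x) = ⨅ t : W, value T (ψ.subst x t) := by
  apply Four.ext_designated <;>
    simp only [Four.neg_iInf, Four.iInf_mem_designated, Four.iSup_mem_designated,
      value_mem_designated, neg_value_mem_designated, hT.all_mem_iff hψ hfree,
      hT.neg_all_mem_iff hψ hfree, Subtype.forall, Subtype.exists, exists_prop]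

end IsHenkin

end Valuations

/-! ### The term model -/

section Symbols

variable {L : FirstOrder.Language.{u, v}}

/-- The function symbols that occur in a term. -/
def termFunctions : L.Term ℕ → Set (Σ k, L.Functions k)
  | .var _ => ∅
  | .func f ts => insert ⟨_, f⟩ (⋃ i, termFunctions (ts i))

theorem termFunctions_countable (t : L.Term ℕ) : (termFunctions t).Countable := by
  induction t with
  | var _ => exact Set.countable_empty
  | func f ts ih => exact (Set.countable_iUnion ih).insert _

namespace UFormula

/-- The function symbols that occur in a formula. -/
def functions : UFormula L → Set (Σ k, L.Functions k)
  | rel _ ts => ⋃ i, termFunctions (ts i)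
  | and φ ψ => φ.functions ∪ ψ.functions
  | or φ ψ => φ.functions ∪ ψ.functions
  | imp φ ψ => φ.functions ∪ ψ.functions
  | neg φ => φ.functions
  | cons φ => φ.functions
  | all _ φ => φ.functions

theorem functions_countable (φ : UFormula L) : φ.functions.Countable := by
  induction φ with
  | rel _ ts => exact Set.countable_iUnion fun i => termFunctions_countable _
  | and φ ψ ih₁ ih₂ | or φ ψ ih₁ ih₂ | imp φ ψ ih₁ ih₂ => exact ih₁.union ih₂
  | neg _ ih | cons _ ih | all _ _ ih => exact ih

/-- The subformulas of a formula, including the formula itself. -/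
def subformulas : UFormula L → Set (UFormula L)
  | rel P ts => {rel P ts}
  | and φ ψ => insert (and φ ψ) (φ.subformulas ∪ ψ.subformulas)
  | or φ ψ => insert (or φ ψ) (φ.subformulas ∪ ψ.subformulas)
  | imp φ ψ => insert (imp φ ψ) (φ.subformulas ∪ ψ.subformulas)
  | neg φ => insert (neg φ) φ.subformulas
  | cons φ => insert (cons φ) φ.subformulas
  | all x φ => insert (all x φ) φ.subformulas

theorem mem_subformulas_self (φ : UFormula L) : φ ∈ φ.subformulas := by
  cases φ with
  | rel => exact rfl
  | _ => exact .inl rfl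

theorem subformulas_countable (φ : UFormula L) : φ.subformulas.Countable := by
  induction φ with
  | rel P ts => exact Set.countable_singleton _
  | and φ ψ ih₁ ih₂ | or φ ψ ih₁ ih₂ | imp φ ψ ih₁ ih₂ => exact (ih₁.union ih₂).insert _
  | neg φ ih | cons φ ih | all x φ ih => exact ih.insert _

end UFormula

end Symbols

section TermModel

open FirstOrder.Language (Term)

variable {L : FirstOrder.Language.{u, v}} {F : Set (Σ k, L.Functions k)} {N : ℕ}

/-- The algebraic language with the function symbols of `F`. -/
def subLanguage (F : Set (Σ k, L.Functions k)) : FirstOrder.Language.{u, 0} :=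
  ⟨fun k => {f : L.Functions k // ⟨k, f⟩ ∈ F}, fun _ => Empty⟩

theorem countable_setOf_termFunctions_subset (hF : F.Countable) :
    {t : L.Term ℕ | termFunctions t ⊆ F}.Countable := by
  have := hF.to_subtype
  have e : F ≃ Σ k, (subLanguage F).Functions k :=
    ⟨fun f => ⟨f.1.1, f.1.2, f.2⟩, fun f => ⟨⟨f.1, f.2.1⟩, f.2.2⟩, fun _ => rfl, fun _ => rfl⟩
  have := Countable.of_equiv F e
  let incl : subLanguage F →ᴸ L := ⟨fun _ f => f.1, fun _ => Empty.elim⟩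
  refine (Set.countable_range incl.onTerm).mono fun t ht => ?_
  induction t with
  | var x => exact ⟨.var x, rfl⟩
  | @func k f ts ih =>
    obtain ⟨hf, hts⟩ := Set.insert_subset_iff.1 ht
    choose ts' hts' using fun i => ih i (Set.iUnion_subset_iff.1 hts i)
    exact ⟨.func (L := subLanguage F) ⟨f, hf⟩ ts', congrArg (Term.func f) (funext hts')⟩

/-- The terms with function symbols in `F` and variables from `N` on. Choosing `N` above all bound
variables of a formula prevents these terms from being captured in it. -/
def termsOver (F : Set (Σ k, L.Functions k)) (N : ℕ) : Set (L.Term ℕ) :=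
  {t | termFunctions t ⊆ F ∧ ∀ x ∈ t.varFinset, N ≤ x}

theorem termsOver_countable (hF : F.Countable) : (termsOver F N).Countable :=
  (countable_setOf_termFunctions_subset hF).mono fun _ ht => ht.1

theorem var_mem_termsOver {n : ℕ} (h : N ≤ n) : .var n ∈ termsOver F N := by
  simpa [termsOver, termFunctions] using h

theorem func_mem_termsOver {k : ℕ} {f : L.Functions k} (hf : ⟨k, f⟩ ∈ F) {ts : Fin k → L.Term ℕ}
    (hts : ∀ i, ts i ∈ termsOver F N) : .func f ts ∈ termsOver F N := by
  refine ⟨Set.insert_subset hf (Set.iUnion_subset fun i => (hts i).1), fun x hx => ?_⟩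
  obtain ⟨i, hi⟩ : ∃ i, x ∈ (ts i).varFinset := by simpa using hx
  exact (hts i).2 x hi

theorem notMem_varFinset_of_mem_termsOver {t : L.Term ℕ} (ht : t ∈ termsOver F N) {x : ℕ}
    (hx : x < N) : x ∉ t.varFinset :=
  fun h => (ht.2 x h).not_gt hx

/-- The term model of a theory `T` on the terms over `F`. A function symbol outside `F` takes the
variable `N` as junk value. -/
noncomputable def termModel (F : Set (Σ k, L.Functions k)) (N : ℕ) (T : Set (UFormula L)) :
    FourStructure.{u, v, u} L where
  Carrier := termsOver F N
  nonempty := ⟨.var N, var_mem_termsOver le_rfl⟩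
  relMap P ts := value T (.rel P fun i => ts i)
  funMap f ts := open Classical in
    if h : .func f (fun i => (ts i : L.Term ℕ)) ∈ termsOver F N then ⟨_, h⟩
    else ⟨.var N, var_mem_termsOver le_rfl⟩

theorem coe_termVal_termModel (T : Set (UFormula L)) {t : L.Term ℕ} (ht : termFunctions t ⊆ F)
    (s : ℕ → termsOver F N) :
    ((termModel F N T).termVal s t).1 = t.subst (Subtype.val ∘ s) := by
  induction t with
  | var x => rfl
  | @func k f ts ih =>
    obtain ⟨hf, hts⟩ := Set.insert_subset_iff.1 ht
    have hmem := func_mem_termsOver hf fun i => ((termModel F N T).termVal s (ts i)).2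
    refine (congrArg Subtype.val (dif_pos hmem)).trans (congrArg (Term.func f) (funext fun i => ?_))
    exact ih i (Set.iUnion_subset_iff.1 hts i)

theorem instances_countable (hF : F.Countable) (φ : UFormula L) :
    (Set.range fun s : ℕ → termsOver F N => φ.msubst (Subtype.val ∘ s)).Countable := by
  have := (termsOver_countable (N := N) hF).to_subtype
  refine (Set.countable_range fun s : φ.freeVars → termsOver F N =>
    φ.msubst fun x => if h : x ∈ φ.freeVars then (s ⟨x, h⟩).1 else .var 0).mono ?_
  rintro _ ⟨s, rfl⟩
  exact ⟨fun x => s x, φ.msubst_congr fun x hx => by simp [hx]⟩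

variable {Δ S T : Set (UFormula L)}

theorem IsHenkin.value_msubst_all (hT : IsHenkin Δ S (termsOver F N) T) {x : ℕ} {φ : UFormula L}
    (hN : ∀ y ∈ (φ.all x).boundVars, y < N) (s : ℕ → termsOver F N)
    (hS : (φ.all x).msubst (Subtype.val ∘ s) ∈ S) :
    value T ((φ.all x).msubst (Subtype.val ∘ s)) =
      ⨅ t : termsOver F N, value T (φ.msubst (Subtype.val ∘ Function.update s x t)) := by
  have hx : x < N := hN x (Finset.mem_insert_self _ _)
  have hφ (y) (hy : y ∈ φ.boundVars) : y < N := hN y (Finset.mem_insert_of_mem hy)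
  refine (hT.value_all hS fun t ht => ?_).trans (iInf_congr fun t => ?_)
  · refine UFormula.freeFor_of_disjoint _ fun y hy => ?_
    rw [UFormula.boundVars_msubst] at hy
    exact notMem_varFinset_of_mem_termsOver ht (hφ y hy)
  · rw [φ.subst_msubst_update, Function.comp_update]
    · exact fun y _ => notMem_varFinset_of_mem_termsOver (s y).2 hx
    · exact fun z hz y => notMem_varFinset_of_mem_termsOver (s y).2 (hφ z hz)

theorem IsHenkin.val_termModel (hT : IsHenkin Δ S (termsOver F N) T) {φ : UFormula L}
    (hF : φ.functions ⊆ F) (hN : ∀ x ∈ φ.boundVars, x < N)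
    (hS : ∀ ψ ∈ φ.subformulas, ∀ s : ℕ → termsOver F N, ψ.msubst (Subtype.val ∘ s) ∈ S)
    (s : ℕ → termsOver F N) :
    (termModel F N T).val φ.toFormula s = value T (φ.msubst (Subtype.val ∘ s)) := by
  induction φ generalizing s with
  | rel P ts =>
    have hts (i) := coe_termVal_termModel T (Set.iUnion_subset_iff.1 hF i) s
    simp only [UFormula.msubst, ← hts]
    rfl
  | and φ ψ ih₁ ih₂ | or φ ψ ih₁ ih₂ | imp φ ψ ih₁ ih₂ =>
    simp only [UFormula.functions, UFormula.boundVars, UFormula.subformulas, Set.union_subset_iff,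
      Finset.mem_union, Set.mem_insert_iff, Set.mem_union] at hF hN hS
    have hφ := hS φ (.inr (.inl φ.mem_subformulas_self)) s
    simp only [UFormula.toFormula, FourStructure.val, UFormula.msubst,
      ih₁ hF.1 (fun x hx => hN x (.inl hx)) (fun θ hθ => hS θ (.inr (.inl hθ))),
      ih₂ hF.2 (fun x hx => hN x (.inr hx)) (fun θ hθ => hS θ (.inr (.inr hθ))),
      hT.value_and (hT.decides_neg _ hφ), hT.value_or (hT.decides _ hφ),
      hT.value_imp (hT.decides _ hφ) (hT.decides_neg _ hφ)]
  | neg φ ih | cons φ ih =>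
    have hφ := hS φ (.inr φ.mem_subformulas_self) s
    simp only [UFormula.toFormula, FourStructure.val, UFormula.msubst,
      ih hF hN fun θ hθ => hS θ (.inr hθ), hT.value_neg,
      hT.value_cons (hT.decides _ hφ) (hT.decides_neg _ hφ)]
  | all x φ ih =>
    rw [hT.value_msubst_all hN s (hS _ (.inl rfl) s)]
    exact iInf_congr fun t =>
      ih hF (fun y hy => hN y (Finset.mem_insert_of_mem hy)) (fun θ hθ => hS θ (.inr hθ)) _

end TermModel

/-! ### Completeness -/

section Completeness

variable {L : FirstOrder.Language.{u, v}}

theorem exists_isModel_of_not_derivable_of_sentences {Δ : Set (UFormula L)} (hfin : Δ.Finite)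
    (hΔ : ∀ δ ∈ Δ, δ.freeVars = ∅) {φ : UFormula L} (hφ : φ.freeVars = ∅)
    (h : ¬Derivable Δ φ) :
    ∃ A : FourStructure.{u, v, u} L,
      (∀ δ ∈ Δ, A.IsModel δ.toFormula) ∧ ¬A.IsModel φ.toFormula := by
  let Θ := insert φ Δ
  have hΘ : Θ.Finite := hfin.insert φ
  have hsent : ∀ θ ∈ Θ, θ.freeVars = ∅ := Set.forall_mem_insert.2 ⟨hφ, hΔ⟩
  let F := ⋃ θ ∈ Θ, θ.functions
  have hF : F.Countable := hΘ.countable.biUnion fun θ _ => θ.functions_countable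
  let N := (hΘ.toFinset.biUnion UFormula.boundVars).sup Nat.succ
  have hN : ∀ θ ∈ Θ, ∀ x ∈ θ.boundVars, x < N := fun θ hθ x hx =>
    Finset.le_sup (f := Nat.succ) (Finset.mem_biUnion.2 ⟨θ, hΘ.mem_toFinset.2 hθ, hx⟩)
  let S := ⋃ θ ∈ Θ, ⋃ ψ ∈ θ.subformulas,
    Set.range fun s : ℕ → termsOver F N => ψ.msubst (Subtype.val ∘ s)
  have hS : S.Countable := hΘ.countable.biUnion fun θ _ =>
    θ.subformulas_countable.biUnion fun ψ _ => instances_countable hF ψ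
  have hvar : ∃ᶠ n in Filter.atTop, .var n ∈ termsOver F N :=
    ((Filter.eventually_ge_atTop N).mono fun n => var_mem_termsOver).frequently
  obtain ⟨T, hT, hφT⟩ := exists_isHenkin hS hvar (consistent_strongNeg_of_not_derivable h)
  have truth (θ) (hθ : θ ∈ Θ) (s) :
      (termModel F N T).val θ.toFormula s ∈ Four.designated ↔ θ ∈ T := by
    have hval := hT.val_termModel (Set.subset_biUnion_of_mem (u := UFormula.functions) hθ)
      (hN θ hθ) (fun ψ hψ s => Set.mem_biUnion hθ (Set.mem_biUnion hψ ⟨s, rfl⟩)) s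
    rw [hval, θ.msubst_of_closed (hsent θ hθ), value_mem_designated]
  refine ⟨termModel F N T, fun δ hδ s => (truth δ (.inr hδ) s).2 (hT.of_derivable (.hyp hδ)),
    fun hA => ?_⟩
  exact hT.strongNeg_notMem ((truth φ (.inl rfl) _).1 (hA fun _ => (termModel F N T).nonempty.some))
    hφT

theorem exists_isModel_of_not_derivable_of_finite {Δ : Set (UFormula L)} (hfin : Δ.Finite)
    {φ : UFormula L} (h : ¬Derivable Δ φ) :
    ∃ A : FourStructure.{u, v, u} L,
      (∀ δ ∈ Δ, A.IsModel δ.toFormula) ∧ ¬A.IsModel φ.toFormula := by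
  have hclose : ¬Derivable (UFormula.close '' Δ) φ.close := fun h' =>
    h <| φ.derivable_close_iff.1 <| h'.trans_hyp <| Set.forall_mem_image.2 fun δ hδ =>
      δ.derivable_close_iff.2 (.hyp hδ)
  obtain ⟨A, hA, hφ⟩ := exists_isModel_of_not_derivable_of_sentences (hfin.image _)
    (Set.forall_mem_image.2 fun δ _ => δ.freeVars_close) φ.freeVars_close hclose
  exact ⟨A, fun δ hδ => (A.isModel_close_iff δ).1 (hA _ (Set.mem_image_of_mem _ hδ)),
    fun h' => hφ ((A.isModel_close_iff φ).2 h')⟩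

theorem derivable_of_consequence {Δ : Set (UFormula L)} {φ : UFormula L}
    (h : Consequence.{u, v, max u v w} (UFormula.toFormula '' Δ) φ.toFormula) :
    Derivable Δ φ := by
  by_contra hd
  obtain ⟨A, hA, hφ⟩ := FourStructure.exists_isModel_of_forall_finset.{u, v, u, max u v w}
    (fun δ : ULift.{w} Δ => δ.down.1.toFormula) φ.toFormula fun I => by
      obtain ⟨A, hA, hφ⟩ := exists_isModel_of_not_derivable_of_finite
        (Δ := (fun δ : ULift.{w} Δ => δ.down.1) '' I) (I.finite_toSet.image _) (φ := φ)
        fun h' => hd (h'.trans_hyp (Set.forall_mem_image.2 fun δ _ => .hyp δ.down.2))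
      exact ⟨A, fun δ hδ => hA _ (Set.mem_image_of_mem _ hδ), hφ⟩
  exact hφ (h A (Set.forall_mem_image.2 fun δ hδ => hA ⟨⟨δ, hδ⟩⟩))

theorem consequence_iff_derivable (Δ : Set (UFormula L)) (φ : UFormula L) :
    Consequence.{u, v, max u v w} (UFormula.toFormula '' Δ) φ.toFormula ↔ Derivable Δ φ :=
  ⟨derivable_of_consequence, fun h A hA =>
    A.isModel_of_derivable h fun _ hδ => hA _ (Set.mem_image_of_mem _ hδ)⟩

theorem consequence_unfoldEx_iff (Δ : Set (Formula L)) (φ : Formula L) :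
    Consequence.{u, v, w} (UFormula.toFormula '' (Formula.unfoldEx '' Δ)) φ.unfoldEx.toFormula ↔
      Consequence.{u, v, w} Δ φ := by
  simp only [Consequence, Set.forall_mem_image, FourStructure.isModel_unfoldEx]

end Completeness

end QBD2

theorem mainTheorem1 (L : FirstOrder.Language.{u, v}) :
    (∀ (Δ : Set (QBD2.UFormula L)) (φ : QBD2.UFormula L),
      QBD2.Consequence.{u, v, max u v w} (QBD2.UFormula.toFormula '' Δ) φ.toFormula ↔
        QBD2.Derivable Δ φ) ∧
    (∀ (Δ : Set (QBD2.Formula L)) (φ : QBD2.Formula L),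
      QBD2.Consequence.{u, v, max u v w} Δ φ ↔
        QBD2.Derivable (QBD2.Formula.unfoldEx '' Δ) φ.unfoldEx) :=
  ⟨QBD2.consequence_iff_derivable.{u, v, w}, fun Δ φ =>
    (QBD2.consequence_unfoldEx_iff Δ φ).symm.trans
      (QBD2.consequence_iff_derivable.{u, v, w} _ _)⟩
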